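/- Let $k$ be a field, $\log=\log_2$. For a monic $P_N\in k[x]$ of degree $N\ge 1$ put $A_N=k[x]/(P_N)$, with the coordinates with respect to $1,x,\dots,x^{N-1}$. Costs are numbers of arithmetic operations ($+,-,\times$, constants of $k$ are free) of division-free straight-line programs over $k$. An element $\omega$ of a commutative ring is a principal $n$-th root of unity if $\omega^n=1$ and $1-\omega^\nu$ is not a zero divisor for $1\le\nu<n$; the DFT of order $n$ with respect to $\omega$ maps $(a_j)_{0\le j<n}$ to $\bigl(\sum_j\omega^{ij}a_j\bigr)_{0\le i<n}$. A DFT program of order $n$ is a straight-line program all of whose steps have the form $u\pm\omega^e v$ (one addition or subtraction together with one multiplication by a power of $\omega$) and which computes the DFT of order $n$ over every commutative ring with a principal $n$-th root of unity $\omega$. **The generic DFT-based algorithm $\mathcal D$ for multiplication in $A_N$.** It is either a base algorithm (any division-free algorithm over $k$ computing the product in $A_N$, $\ell=0$ recursive steps), or it performs a recursive step as follows. Write $N=N'N''$ with $N''\ge 2$ and choose an algebra $A_{N'}=k[y]/(P_{N'})$ containing a principal root of unity $\omega$ whose order is $N''$ or a multiple $dN''$ of it (in particular $A_{N'}$ contains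 a principal $N''$-th root of unity), programs over $k$ that multiply elements of $A_{N'}$ by the powers of $\omega$, and $k$-linear maps $\psi:A_N\to(A_{N'})^{2N''}$ and $\psi^{-1}:(A_{N'})^{2N''}\to A_N$ such that $\psi^{-1}(\psi(a)\cdot\psi(b))=ab$ for all $a,b\in A_N$, the product of $\psi(a)$ and $\psi(b)$ being componentwise (so $\psi$ is injective). Each of $\psi,\psi^{-1}$ is computed by a program over $k$, followed by one or more DFTs over $A_{N'}$, all of the same order $mN''$ ($m\ge1$) and with respect to the same power of $\omega$ that is a principal $mN''$-th root of unity, performed by a DFT program, followed by a program over $k$. Then $ab$ is computed by applying $\psi$ to $a$ and to $b$, multiplying the $2N''$ pairs of components in $A_{N'}$ by the algorithm of the same kind chosen for $A_{N'}$, and applying $\psi^{-1}$. Let $\ell$ be the number of recursive steps, $N'_0=N$, and $N'_\lambda,N''_\lambda$ the parameters chosen in step $\lambda=1,\dots,\ell$, so that $N'_{\lambda-1}=N'_\lambda N''_\lambda$. Let $M^\ast(N'_\lambda)$ be the cost of the multiplication of an element of $A_{N'_\lambda}$ by powers of the chosen root of unity (the maximal length of the chosen programs, over all powers), and $M(N'_\lambda)=\max\{1,M^\ast(N'_\lambda)/N'_\lambda\}$.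 Let $L'_{\mathcal D}(N)$ be the total number of operations in $k$, where a step $u\pm\omega^e v$ over $A_{N'}$ is charged $N'+M^\ast(N')$ operations. Let $C$ be a constant, and consider those algorithms $\mathcal D$ for which: $N'_\ell\le C$ and the base algorithm has cost at most $C$; in each step $d\le C$, and each of $\psi,\psi^{-1}$ uses at most $C$ DFTs, of order $\nu=mN''$ with $m\le C$, the DFT program having at most $C\,\nu\log\nu$ steps, and its two programs over $k$ have length at most $C$ times the dimension of the algebra in which this step multiplies. Then the following holds for all $N$, all $P_N$ and all such $\mathcal D$, with implied constants that are positive and depend only on $k$ and $C$. 1. $$L'_{\mathcal D}(N)=\Theta\Bigl(N\cdot 2^\ell+N\sum_{\lambda=1}^{\ell}2^{\lambda-1}M(N'_\lambda)\log N''_\lambda\Bigr).$$ 2. If $\operatorname{char}k\ne 2$, then $$L'_{\mathcal D}(N)=\Omega\Bigl(N\cdot 2^{(f_k^\vee)^\ast(N)}+N\sum_{\lambda=1}^{(f_k^\vee)^\ast(N)-1}2^{\lambda-1}\log (f_k^\vee)^{(\lambda)}(N)\Bigr).$$ Here, for $i\ge1$ not divisible by $\operatorname{char}k$, $f_k(i)=[k(\omega_i):k]$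 with $\omega_i$ a primitive $i$-th root of unity in the algebraic closure of $k$; $f_k^\vee(n)$ is the least value $f_k(i)$ over all such $i$ with $i\,f_k(i)\ge n$; $f^{(\lambda)}$ is the $\lambda$-fold iterate of $f$; and $f^\ast(n)$ is the least $i$ with $f^{(i)}(n)=f^{(i+1)}(n)$. -/

import Mathlib

open Polynomial

universe u

/-! ### Straight-line programs over the ground field -/

/-- The three division-free arithmetic operations. -/
inductive ArithOp
  | add
  | sub
  | mul

/-- The value of an arithmetic operation. -/
def ArithOp.eval {k : Type u} [Field k] : ArithOp → k → k → k
  | .add, a, b => a + b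
  | .sub, a, b => a - b
  | .mul, a, b => a * b

/-- An operand of a step: an input, the value computed by step number `j` (counted from `0`),
or a constant of the ground field. -/
inductive Operand (k : Type u) (ι : Type)
  | input (i : ι)
  | prev (j : ℕ)
  | const (c : k)

/-- The value of an operand, for the inputs `x` and the list `w` of values computed so far.
A reference to a step that has not been performed yet is read as the constant `0`. -/
def Operand.eval {k : Type u} [Field k] {ι : Type} (x : ι → k) (w : List k) : Operand k ι → k
  | .input i => x i
  | .prev j => w.getD j 0
  | .const c => c

/-- A division-free algebraic algorithm over `k` with inputs indexed by `ι` and outputs indexed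
by `κ`: a list of arithmetic steps, and for each output the operand which holds it. -/
structure SLP (k : Type u) (ι κ : Type) where
  steps : List (ArithOp × Operand k ι × Operand k ι)
  out : κ → Operand k ι

/-- The list of all values computed by the program. -/
def SLP.values {k : Type u} [Field k] {ι κ : Type} (p : SLP k ι κ) (x : ι → k) : List k :=
  p.steps.foldl (fun w s => w ++ [s.1.eval (s.2.1.eval x w) (s.2.2.eval x w)]) []

/-- The function computed by the program. -/
def SLP.eval {k : Type u} [Field k] {ι κ : Type} (p : SLP k ι κ) (x : ι → k) : κ → k :=
  fun j => (p.out j).eval x (p.values x)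

/-- The arithmetic complexity of the program: its number of steps. -/
def SLP.length {k : Type u} {ι κ : Type} (p : SLP k ι κ) : ℕ := p.steps.length

/-! ### Discrete Fourier transforms -/

/-- `ω` is a principal `n`-th root of unity: `ω ^ n = 1`, and `1 - ω ^ ν` is not a zero divisor
for `1 ≤ ν < n`. -/
def IsPrincipalRoot {R : Type u} [CommRing R] (ω : R) (n : ℕ) : Prop :=
  ω ^ n = 1 ∧ ∀ ν : ℕ, 1 ≤ ν → ν < n → 1 - ω ^ ν ∈ nonZeroDivisors R

/-- The discrete Fourier transform of order `n` with respect to `ω`. -/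
def dft {R : Type u} [CommRing R] (n : ℕ) (ω : R) (a : Fin n → R) : Fin n → R :=
  fun i => ∑ j : Fin n, ω ^ ((i : ℕ) * (j : ℕ)) * a j

/-- One step of a fast Fourier transform: from the registers `left` and `right` it computes
`left + ω ^ exp * right`, or `left - ω ^ exp * right` if `neg` is set. It consists of one
addition (or subtraction) and one multiplication by a power of `ω`. -/
structure Butterfly where
  left : ℕ
  right : ℕ
  exp : ℕ
  neg : Bool

/-- A program of butterfly steps. Registers `0, …, n - 1` hold the inputs, every step appends one
register, and output `i` is read from register `out i`. -/
structure DFTProgram (n : ℕ) where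
  gates : List Butterfly
  out : Fin n → ℕ

/-- Run the program over the ring `R` with the root `ω`.
Registers which do not exist are read as `0`. -/
def DFTProgram.run {n : ℕ} (p : DFTProgram n) {R : Type u} [CommRing R] (ω : R)
    (a : Fin n → R) : Fin n → R :=
  fun i => (p.gates.foldl (fun w g =>
    w ++ [w.getD g.left 0 + (if g.neg then -1 else 1) * (ω ^ g.exp * w.getD g.right 0)])
    (List.ofFn a)).getD (p.out i) 0

/-- The program is a DFT algorithm of order `n`: over every commutative ring and for every
principal `n`-th root of unity `ω` of that ring it computes the DFT with respect to `ω`. -/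
def DFTProgram.ComputesDFT.{v} {n : ℕ} (p : DFTProgram n) : Prop :=
  ∀ (R : Type v) [CommRing R] (ω : R), IsPrincipalRoot ω n →
    ∀ a : Fin n → R, p.run ω a = dft n ω a

/-! ### The algebras `A_N = k[x] / P_N(x)` -/

/-- A monic polynomial `P_N` of positive degree `N`. -/
structure Modulus (k : Type u) [Field k] where
  poly : k[X]
  monic : poly.Monic
  deg_pos : 0 < poly.natDegree

/-- The degree `N` of `P_N`, which is the dimension of `A_N`. -/
noncomputable abbrev Modulus.dim {k : Type u} [Field k] (P : Modulus k) : ℕ := P.poly.natDegree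

/-- The algebra `A_N = k[x] / P_N(x)`. -/
abbrev Modulus.Alg {k : Type u} [Field k] (P : Modulus k) : Type u := AdjoinRoot P.poly

/-- The coordinates of an element of `A_N` in the basis `1, x, …, x ^ (N - 1)`. -/
noncomputable def Modulus.coords {k : Type u} [Field k] (P : Modulus k) :
    P.Alg ≃ₗ[k] (Fin P.dim → k) :=
  ((AdjoinRoot.powerBasis' P.monic).basis.reindex
    (finCongr (AdjoinRoot.powerBasis'_dim P.monic))).equivFun

/-! ### The generic DFT-based algorithm -/

/-- A map `k ^ ι → k ^ κ` computed by means of DFTs over `A_{N'}` (the algebra of `Q`):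
a preparation over `k`, then `count ≥ 1` DFTs over `A_{N'}`, all of the same order
`factor * n` (where `n` stands for `N''`) and with respect to the same power `ω ^ exp` of the
given root of unity `ω`, then a finishing computation over `k`. -/
structure DFTTransform {k : Type u} [Field k] (Q : Modulus k) (ω : Q.Alg) (n : ℕ)
    (ι κ : Type) where
  factor : ℕ
  factor_pos : 0 < factor
  count : ℕ
  count_pos : 0 < count
  exp : ℕ
  principal : IsPrincipalRoot (ω ^ exp) (factor * n)
  pre : SLP k ι (Fin count × Fin (factor * n) × Fin Q.dim)
  prog : DFTProgram (factor * n)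
  prog_dft : DFTProgram.ComputesDFT.{u} prog
  post : SLP k (Fin count × Fin (factor * n) × Fin Q.dim) κ

namespace DFTTransform

variable {k : Type u} [Field k] {Q : Modulus k} {ω : Q.Alg} {n : ℕ} {ι κ : Type}

/-- The map computed by the transform. -/
noncomputable def eval (T : DFTTransform Q ω n ι κ) (v : ι → k) : κ → k :=
  T.post.eval fun x =>
    Q.coords (T.prog.run (ω ^ T.exp)
      (fun i => Q.coords.symm fun t => T.pre.eval v (x.1, i, t)) x.2.1) x.2.2

/-- The number of operations in `k`, if every multiplication of an element of `A_{N'}` by a power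
of `ω` takes `m` operations; an addition in `A_{N'}` takes `N'` operations. -/
noncomputable def cost (T : DFTTransform Q ω n ι κ) (m : ℕ) : ℕ :=
  T.pre.length + T.count * (T.prog.gates.length * (Q.dim + m)) + T.post.length

/-- The implied constants are at most `C`: a bounded number of DFTs of order `O(n)`, each
performed in at most `C * ν * log ν` steps where `ν` is its order, and at most `C * N` further
operations in `k`. -/
def Bounded (T : DFTTransform Q ω n ι κ) (N C : ℕ) : Prop :=
  T.factor ≤ C ∧ T.count ≤ C ∧ T.pre.length ≤ C * N ∧ T.post.length ≤ C * N ∧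
  (T.prog.gates.length : ℝ) ≤
    C * ((T.factor * n : ℕ) : ℝ) * Real.logb 2 ((T.factor * n : ℕ) : ℝ)

/-- A transform from `k ^ N` to `k ^ (r * N')`, as a map from `A_N` to `(A_{N'}) ^ r`. -/
noncomputable def toVec {P : Modulus k} {r : ℕ}
    (T : DFTTransform Q ω n (Fin P.dim) (Fin r × Fin Q.dim)) (a : P.Alg) : Fin r → Q.Alg :=
  fun j => Q.coords.symm fun t => T.eval (P.coords a) (j, t)

/-- A transform from `k ^ (r * N')` to `k ^ N`, as a map from `(A_{N'}) ^ r` to `A_N`. -/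
noncomputable def ofVec {P : Modulus k} {r : ℕ}
    (T : DFTTransform Q ω n (Fin r × Fin Q.dim) (Fin P.dim)) (c : Fin r → Q.Alg) : P.Alg :=
  P.coords.symm (T.eval fun x => Q.coords (c x.1) x.2)

end DFTTransform

/-- The data of one recursive step, which reduces one multiplication in `A_N` (the algebra of `P`)
to `2 * N''` multiplications in `A_{N'}` (the algebra of `Q`), where `N = N' * N''`. -/
structure RecStep {k : Type u} [Field k] (P Q : Modulus k) where
  /-- `N''` -/
  order : ℕ
  two_le_order : 2 ≤ order
  dim_eq : P.dim = Q.dim * order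
  /-- `A_{N'}` contains the principal root of unity `root` of order `mult * N''`
  (`mult = 1`, or `mult = 2`, or another bounded factor). -/
  mult : ℕ
  mult_pos : 0 < mult
  root : Q.Alg
  root_principal : IsPrincipalRoot root (mult * order)
  /-- Programs which multiply elements of `A_{N'}` by the powers of `root`. -/
  mulPow : Fin (mult * order) → SLP k (Fin Q.dim) (Fin Q.dim)
  mulPow_correct : ∀ e a, (mulPow e).eval (Q.coords a) = Q.coords (root ^ (e : ℕ) * a)
  /-- The transformation `ψ`. -/
  psi : DFTTransform Q root order (Fin P.dim) (Fin (2 * order) × Fin Q.dim)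
  /-- The back-transformation `ψ⁻¹`, followed by the reduction to an element of `A_N`. -/
  psiInv : DFTTransform Q root order (Fin (2 * order) × Fin Q.dim) (Fin P.dim)
  psi_linear : IsLinearMap k (psi.toVec (P := P))
  psiInv_linear : IsLinearMap k (psiInv.ofVec (P := P))
  /-- The product in `A_N` is recovered from the componentwise product in `(A_{N'}) ^ (2 * N'')`. -/
  correct : ∀ a b : P.Alg, psiInv.ofVec (psi.toVec a * psi.toVec b) = a * b

namespace RecStep

variable {k : Type u} [Field k] {P Q : Modulus k}

/-- `M*(N')`: the number of operations in `k` which the algorithm uses to multiply an element of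
`A_{N'}` by a power of the root of unity (the maximum over all powers). -/
def mulPowCost (s : RecStep P Q) : ℕ :=
  Finset.univ.sup fun e => (s.mulPow e).length

/-- The implied constants of this step are at most `C`. -/
def Bounded (s : RecStep P Q) (C : ℕ) : Prop :=
  s.mult ≤ C ∧ s.psi.Bounded P.dim C ∧ s.psiInv.Bounded P.dim C

/-- `ψ` is injective. -/
theorem psi_injective (s : RecStep P Q) : Function.Injective (s.psi.toVec (P := P)) := by
  intro a b h
  have ha := s.correct a 1
  rw [h, s.correct b 1, mul_one, mul_one] at ha
  exact ha.symm

end RecStep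

/-- The generic DFT-based algorithm for multiplication in `A_N`: either a base algorithm, which is
an arbitrary division-free algorithm over `k`, or a recursive step together with an algorithm of
the same kind for multiplication in `A_{N'}`. -/
inductive DFTAlg {k : Type u} [Field k] : Modulus k → Type u
  | base {P : Modulus k} (prog : SLP k (Fin P.dim ⊕ Fin P.dim) (Fin P.dim))
      (correct : ∀ a b : P.Alg,
        prog.eval (Sum.elim (P.coords a) (P.coords b)) = P.coords (a * b)) : DFTAlg P
  | step {P Q : Modulus k} (s : RecStep P Q) (D : DFTAlg Q) : DFTAlg P

namespace DFTAlg

variable {k : Type u} [Field k]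

/-- The result of the algorithm on two elements of `A_N`. -/
noncomputable def eval : {P : Modulus k} → DFTAlg P → P.Alg → P.Alg → P.Alg
  | P, .base prog _, a, b => P.coords.symm (prog.eval (Sum.elim (P.coords a) (P.coords b)))
  | _, .step s D, a, b => s.psiInv.ofVec fun j => D.eval (s.psi.toVec a j) (s.psi.toVec b j)

/-- The algorithm computes the product in `A_N`. -/
theorem eval_eq_mul {P : Modulus k} (D : DFTAlg P) (a b : P.Alg) : D.eval a b = a * b := by
  induction D with
  | base prog h => simp [eval, h]
  | step s D ih =>
    simp only [eval, ih]
    exact s.correct a b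

/-- `L'(N)`: the total number of operations in `k`. A recursive step performs `2 * N''`
multiplications in `A_{N'}`, the transformation `ψ` twice and the back-transformation once. -/
noncomputable def cost : {P : Modulus k} → DFTAlg P → ℕ
  | _, .base prog _ => prog.length
  | _, .step s D =>
    2 * s.order * D.cost + 2 * s.psi.cost s.mulPowCost + s.psiInv.cost s.mulPowCost

/-- `ℓ`: the number of recursive steps. -/
def depth : {P : Modulus k} → DFTAlg P → ℕ
  | _, .base _ _ => 0
  | _, .step _ D => D.depth + 1

/-- `N'_i` for `0 ≤ i ≤ ℓ`, where `N'_0 = N` (and `0` for `i > ℓ`). -/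
noncomputable def dimAt : {P : Modulus k} → DFTAlg P → ℕ → ℕ
  | P, _, 0 => P.dim
  | _, .base _ _, _ + 1 => 0
  | _, .step _ D, i + 1 => D.dimAt i

/-- `N''_i` for `1 ≤ i ≤ ℓ` (and `0` for all other `i`). -/
def orderAt : {P : Modulus k} → DFTAlg P → ℕ → ℕ
  | _, .base _ _, _ => 0
  | _, .step _ _, 0 => 0
  | _, .step s _, 1 => s.order
  | _, .step _ D, i + 2 => D.orderAt (i + 1)

/-- `M*(N'_i)` for `1 ≤ i ≤ ℓ` (and `0` for all other `i`). -/
def mulPowCostAt : {P : Modulus k} → DFTAlg P → ℕ → ℕ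
  | _, .base _ _, _ => 0
  | _, .step _ _, 0 => 0
  | _, .step s _, 1 => s.mulPowCost
  | _, .step _ D, i + 2 => D.mulPowCostAt (i + 1)

/-- The normalized cost `M(N'_i) = max {1, M*(N'_i) / N'_i}`. -/
noncomputable def normMulPowCostAt {P : Modulus k} (D : DFTAlg P) (i : ℕ) : ℝ :=
  max 1 ((D.mulPowCostAt i : ℝ) / (D.dimAt i : ℝ))

/-- All constants which are implicit in the description of the algorithm are at most `C`; for the
base algorithm this means that its dimension `N'_ℓ` and its cost are at most `C`. -/
def Bounded : {P : Modulus k} → DFTAlg P → ℕ → Prop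
  | P, .base prog _, C => P.dim ≤ C ∧ prog.length ≤ C
  | _, .step s D, C => s.Bounded C ∧ D.Bounded C

end DFTAlg

/-! ### The degree function and its iterated inverse -/

/-- The degree function `f_k(n) = [k(ω_n) : k]`, where `ω_n` is a primitive `n`-th root of unity
in the algebraic closure of `k`. It is meaningful if such a root exists, that is, if `n` is
nonzero in `k`. -/
noncomputable def degreeFn (k : Type u) [Field k] (n : ℕ) : ℕ :=
  Module.finrank k
    (IntermediateField.adjoin k {ζ : AlgebraicClosure k | IsPrimitiveRoot ζ n})

/-- `f_k^∨(n)`: the least value `f_k(i)` over all positive integers `i` for which `f_k(i)` is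
defined and `i * f_k(i) ≥ n`. -/
noncomputable def invDegreeFn (k : Type u) [Field k] (n : ℕ) : ℕ :=
  sInf {d : ℕ | ∃ i : ℕ, (i : k) ≠ 0 ∧ n ≤ i * degreeFn k i ∧ d = degreeFn k i}

/-- `f^*(n)`: the number of iterations of `f` after which the sequence
`n, f(n), f(f(n)), …` becomes stationary. -/
noncomputable def iterStar (f : ℕ → ℕ) (n : ℕ) : ℕ :=
  sInf {i : ℕ | f^[i + 1] n = f^[i] n}

/-! Part 1 unrolls the recursion `L'(N) = 2 N'' L'(N') +` (three transforms). The right-hand side `N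
2^ℓ + N ∑ ...` satisfies the same recursion with increment `N M(N') log N''`, so it suffices to
compare this increment with the cost of a transform. The upper bound on that cost is built into
`Bounded`. The lower bound is Morgenstern's determinant argument: a butterfly step at most doubles
the largest minor in absolute value, while the Fourier matrix has determinant of modulus `n^(n/2)`;
hence at least `(n log n) / 2` steps are needed (`DFTProgram.mul_logb_le`).

For part 2, a residue field of `A_{N'}` contains a primitive `N''`-th root of unity, so `f_k(N'') ≤
N'`. Doubling the index at most doubles `f_k`, which turns this into `f_k^∨(N) ≤ 2 N'`. The
algorithm therefore cannot shrink the dimension essentially faster than `f_k^∨` does. The factor 2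
does not accumulate, because `f_k^∨(4 n) ≤ 2 f_k^∨(n)`: the invariant `n ≤ 4 N` passes to `f_k^∨(n)
≤ 4 N'`. `DFTAlg.iterBound_le` carries this invariant through the recursion. -/

/-- The registers of a butterfly program, started on the list `w`. -/
def butterflyFold {R : Type u} [CommRing R] (ω : R) (gates : List Butterfly) (w : List R) :
    List R :=
  gates.foldl (fun w g =>
    w ++ [w.getD g.left 0 + (if g.neg then -1 else 1) * (ω ^ g.exp * w.getD g.right 0)]) w

theorem DFTProgram.run_eq {n : ℕ} (p : DFTProgram n) {R : Type u} [CommRing R] (ω : R)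
    (a : Fin n → R) (i : Fin n) :
    p.run ω a i = (butterflyFold ω p.gates (List.ofFn a)).getD (p.out i) 0 := rfl

/-! ### Morgenstern's determinant bound for DFT programs. -/

section Determinant

variable {ι : Type u} [Fintype ι] [DecidableEq ι]

/-- The square matrix whose rows are the vectors of the list `w` with the indices `σ`
(rows with an index out of range are zero). -/
def rowMatrix (w : List (ι → ℂ)) (σ : ι → ℕ) : Matrix ι ι ℂ :=
  Matrix.of fun i => w.getD (σ i) 0

theorem det_rowMatrix_eq_zero (w : List (ι → ℂ)) {σ : ι → ℕ} (hσ : ¬ Function.Injective σ) :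
    (rowMatrix w σ).det = 0 := by
  obtain ⟨i, j, hij, hne⟩ : ∃ i j, σ i = σ j ∧ i ≠ j := by
    simpa [Function.Injective] using hσ
  refine Matrix.det_zero_of_row_eq hne ?_
  funext l
  simp [rowMatrix, hij]

theorem getD_append_singleton_of_ne {α : Type*} (w : List α) (x d : α) {m : ℕ}
    (hm : m ≠ w.length) : (w ++ [x]).getD m d = w.getD m d := by
  rcases lt_or_gt_of_ne hm with h | h
  · simp [List.getD_eq_getElem?_getD, List.getElem?_append_left h]
  · simp only [List.getD_eq_getElem?_getD]
    rw [List.getElem?_eq_none (by simp; omega), List.getElem?_eq_none h.le]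

/-- In a nonzero minor the new register occurs in only one row. Expanding linearly in that row gives
two minors of the old list, one of them with a coefficient of modulus 1. -/
theorem norm_det_append_le {w : List (ι → ℂ)} {B : ℝ}
    (hw : ∀ σ : ι → ℕ, ‖(rowMatrix w σ).det‖ ≤ B)
    (l r : ℕ) (c : ℂ) (hc : ‖c‖ = 1) (σ : ι → ℕ) :
    ‖(rowMatrix (w ++ [w.getD l 0 + c • w.getD r 0]) σ).det‖ ≤ 2 * B := by
  have hB : 0 ≤ B := (norm_nonneg _).trans (hw σ)
  by_cases hσ : Function.Injective σ
  swap
  · rw [det_rowMatrix_eq_zero _ hσ]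
    simpa using hB
  by_cases hlen : ∃ i, σ i = w.length
  swap
  · push Not at hlen
    have : rowMatrix (w ++ [w.getD l 0 + c • w.getD r 0]) σ = rowMatrix w σ := by
      ext i j
      simp only [rowMatrix, Matrix.of_apply, getD_append_singleton_of_ne _ _ _ (hlen i)]
    rw [this]
    linarith [hw σ]
  obtain ⟨i, hi⟩ := hlen
  have hrow : ∀ m : ℕ, rowMatrix w (Function.update σ i m)
      = (rowMatrix w σ).updateRow i (w.getD m 0) := by
    intro m
    ext j t
    by_cases h : j = i
    · subst h; simp [rowMatrix]
    · simp [rowMatrix, h]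
  have hnew : rowMatrix (w ++ [w.getD l 0 + c • w.getD r 0]) σ
      = (rowMatrix w σ).updateRow i (w.getD l 0 + c • w.getD r 0) := by
    ext j t
    by_cases h : j = i
    · subst h; simp [rowMatrix, hi]
    · rw [Matrix.updateRow_ne h]
      simp only [rowMatrix, Matrix.of_apply]
      rw [getD_append_singleton_of_ne _ _ _ fun h' => h (hσ (h'.trans hi.symm))]
  have h1 := hw (Function.update σ i l)
  have h2 := hw (Function.update σ i r)
  rw [hrow] at h1 h2
  rw [hnew, Matrix.det_updateRow_add, Matrix.det_updateRow_smul]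
  calc _ ≤ _ := norm_add_le _ _
    _ ≤ B + B := by
      rw [norm_mul, hc, one_mul]
      exact add_le_add h1 h2
    _ = 2 * B := by ring

theorem norm_det_butterflyFold_le {ω : ℂ} (hω : ‖ω‖ = 1) (gates : List Butterfly) :
    ∀ {w : List (ι → ℂ)} {B : ℝ},
      (∀ σ : ι → ℕ, ‖(rowMatrix w σ).det‖ ≤ B) → ∀ σ : ι → ℕ,
      ‖(rowMatrix (butterflyFold (fun _ => ω) gates w) σ).det‖ ≤ 2 ^ gates.length * B := by
  induction gates with
  | nil =>
    intro w B hw σ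
    simpa [butterflyFold] using hw σ
  | cons g gates ih =>
    intro w B hw σ
    have hstep : w.getD g.left 0 +
        (if g.neg then -1 else 1) * ((fun _ => ω) ^ g.exp * w.getD g.right 0) =
        w.getD g.left 0 + ((if g.neg then -1 else 1) * ω ^ g.exp) • w.getD g.right 0 := by
      funext i
      by_cases h : g.neg <;> simp [h]
    have hc : ‖(if g.neg then -1 else 1) * ω ^ g.exp‖ = 1 := by
      by_cases h : g.neg <;> simp [h, hω]
    have := ih (norm_det_append_le hw g.left g.right _ hc) σ
    rw [← hstep] at this
    rw [List.length_cons, pow_succ, mul_assoc]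
    exact this

end Determinant

/-- Start of the induction: a minor of the input registers is zero or the determinant of a
permutation matrix. -/
theorem norm_det_unit_rows_le {n : ℕ} (σ : ULift.{u} (Fin n) → ℕ) :
    ‖(rowMatrix (List.ofFn fun j : Fin n =>
      (Pi.single (ULift.up j) 1 : ULift.{u} (Fin n) → ℂ)) σ).det‖ ≤ 1 := by
  by_cases hσ : Function.Injective σ
  swap
  · rw [det_rowMatrix_eq_zero _ hσ]
    simp
  by_cases hlt : ∀ i, σ i < n
  swap
  · push Not at hlt
    obtain ⟨i, hi⟩ := hlt
    rw [Matrix.det_eq_zero_of_row_eq_zero i]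
    · simp
    · intro j
      rw [rowMatrix, Matrix.of_apply, List.getD_eq_default _ _ (by simpa using hi)]
      rfl
  let τ : ULift.{u} (Fin n) → ULift.{u} (Fin n) := fun i => ⟨⟨σ i, hlt i⟩⟩
  have hτ : Function.Injective τ := fun i j h => hσ (by simpa [τ] using h)
  let e := Equiv.ofBijective τ (Finite.injective_iff_bijective.mp hτ)
  have : rowMatrix (List.ofFn fun j : Fin n =>
      (Pi.single (ULift.up j) 1 : ULift.{u} (Fin n) → ℂ)) σ
      = (1 : Matrix (ULift.{u} (Fin n)) (ULift.{u} (Fin n)) ℂ).submatrix e id := by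
    ext i j
    rw [rowMatrix, Matrix.of_apply, List.getD_eq_getElem _ _ (by simpa using hlt i)]
    simp [e, τ, Matrix.one_apply, Pi.single_apply, eq_comm]
  rw [this, Matrix.det_permute, Matrix.det_one, mul_one]
  rcases Int.units_eq_one_or (Equiv.Perm.sign e) with h | h <;> simp [h]

/-- The matrix of the discrete Fourier transform of order `n` over `ℂ`. -/
def fourierMatrix (n : ℕ) (ω : ℂ) : Matrix (ULift.{u} (Fin n)) (ULift.{u} (Fin n)) ℂ :=
  Matrix.of fun i j => ω ^ ((i.down : ℕ) * (j.down : ℕ))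

theorem norm_det_fourierMatrix_sq {n : ℕ} {ω : ℂ} (hω : IsPrimitiveRoot ω n) (hn : n ≠ 0) :
    ‖(fourierMatrix.{u} n ω).det‖ ^ 2 = (n : ℝ) ^ n := by
  set A := fourierMatrix.{u} n ω with hA
  have hnorm : ‖ω‖ = 1 := hω.norm'_eq_one hn
  have hω0 : ω ≠ 0 := hω.ne_zero hn
  -- Since conjugation inverts `ω`, orthogonality of the characters gives `A A* = n I`.
  have hconj : (starRingEnd ℂ) ω = ω⁻¹ := by
    rw [Complex.inv_def, Complex.normSq_eq_norm_sq, hnorm]; simp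
  have hmul : A * A.conjTranspose = (n : ℂ) • (1 : Matrix _ _ ℂ) := by
    ext i j
    have hsum : (A * A.conjTranspose) i j
        = ∑ t ∈ Finset.range n, (ω ^ (i.down : ℕ) * (ω⁻¹) ^ (j.down : ℕ)) ^ t := by
      rw [Matrix.mul_apply, ← Equiv.ulift.symm.sum_comp, Finset.sum_range]
      refine Finset.sum_congr rfl fun t _ => ?_
      simp [A, fourierMatrix, Matrix.conjTranspose_apply, hconj, mul_pow, pow_mul]
    rw [hsum]
    by_cases hij : i = j
    · subst hij
      simp [hω0]
    · rw [Matrix.smul_apply, Matrix.one_apply_ne hij, smul_zero]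
      have hne : ω ^ (i.down : ℕ) * (ω⁻¹) ^ (j.down : ℕ) ≠ 1 := by
        intro h
        apply hij
        rw [inv_pow, mul_inv_eq_one₀ (pow_ne_zero _ hω0)] at h
        exact ULift.ext _ _ (Fin.ext (hω.pow_inj i.down.2 j.down.2 h))
      have hpow : (ω ^ (i.down : ℕ) * (ω⁻¹) ^ (j.down : ℕ)) ^ n = 1 := by
        rw [mul_pow, ← pow_mul, ← pow_mul, mul_comm _ n, mul_comm _ n, pow_mul, pow_mul,
          inv_pow, hω.pow_eq_one]
        simp
      rw [geom_sum_eq hne, hpow]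
      simp
  have hdet := congrArg (fun M => ‖Matrix.det M‖) hmul
  simpa [Matrix.det_mul, Matrix.det_conjTranspose, Matrix.det_smul, sq] using hdet

/-- Morgenstern's lower bound: a program of `g` butterfly steps which computes the DFT of order
`n` satisfies `n ^ n ≤ 4 ^ g`. -/
theorem DFTProgram.pow_self_le_four_pow {n : ℕ} (hn : n ≠ 0) (p : DFTProgram n)
    (hp : DFTProgram.ComputesDFT.{u} p) : (n : ℝ) ^ n ≤ 4 ^ p.gates.length := by
  have hω := Complex.isPrimitiveRoot_exp n hn
  set ω := Complex.exp (2 * Real.pi * Complex.I / n) with hωdef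
  -- The program is run over the product ring `ℂ^n` on the unit vectors, so each register holds the
  -- coefficient vector of the linear form it computes. `ULift` puts this ring into the universe in
  -- which the program is known to be correct.
  have hprin : IsPrincipalRoot (fun _ : ULift.{u} (Fin n) => ω) n := by
    refine ⟨by funext i; simpa using hω.pow_eq_one, fun ν h1 h2 => ?_⟩
    rw [mem_nonZeroDivisors_iff_right]
    intro x hx
    funext i
    have := congrFun hx i
    simp only [Pi.mul_apply, Pi.sub_apply, Pi.one_apply, Pi.pow_apply, Pi.zero_apply,
      mul_eq_zero, sub_eq_zero] at this
    exact this.resolve_right fun h => hω.pow_ne_one_of_pos_of_lt (by omega) h2 h.symm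
  have hrun := hp _ _ hprin fun j => Pi.single (ULift.up j) 1
  have hbound := norm_det_butterflyFold_le (hω.norm'_eq_one hn) p.gates
    (norm_det_unit_rows_le.{u} (n := n)) (fun i => p.out i.down)
  have hmat : rowMatrix (butterflyFold (fun _ => ω) p.gates (List.ofFn fun j : Fin n =>
      (Pi.single (ULift.up j) 1 : ULift.{u} (Fin n) → ℂ))) (fun i => p.out i.down)
      = fourierMatrix.{u} n ω := by
    ext i j
    rw [rowMatrix, fourierMatrix, Matrix.of_apply, Matrix.of_apply, ← DFTProgram.run_eq, hrun]
    simp only [dft, Finset.sum_apply, Pi.mul_apply, Pi.pow_apply]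
    rw [Finset.sum_eq_single j.down]
    · simp
    · intro b _ hb
      rw [Pi.single_eq_of_ne (fun h => hb (by rw [h])), mul_zero]
    · simp
  rw [hmat, mul_one] at hbound
  rw [← norm_det_fourierMatrix_sq.{u} hω hn]
  calc _ ≤ ((2 : ℝ) ^ p.gates.length) ^ 2 := by gcongr
    _ = 4 ^ p.gates.length := by rw [← pow_mul, mul_comm, pow_mul]; norm_num

theorem DFTProgram.mul_logb_le {n : ℕ} (hn : n ≠ 0) (p : DFTProgram n)
    (hp : DFTProgram.ComputesDFT.{u} p) :
    (n : ℝ) * Real.logb 2 n ≤ 2 * p.gates.length := by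
  have hn' : (0 : ℝ) < n := by positivity
  have h := Real.logb_le_logb_of_le (b := 2) (by norm_num) (by positivity)
    (p.pow_self_le_four_pow hn hp)
  rw [Real.logb_pow, show (4 : ℝ) = 2 ^ 2 by norm_num, ← pow_mul, Real.logb_pow,
    Real.logb_self_eq_one (by norm_num)] at h
  push_cast at h
  linarith

/-! ### The degree function and roots of unity in `A_{N'}`. -/

section DegreeFn

variable {k : Type u} [Field k]

theorem exists_isPrimitiveRoot_algebraicClosure {n : ℕ} (hn : (n : k) ≠ 0) :
    ∃ ζ : AlgebraicClosure k, IsPrimitiveRoot ζ n := by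
  have h0 : (n : AlgebraicClosure k) ≠ 0 := by
    rw [← map_natCast (algebraMap k (AlgebraicClosure k))]
    exact (_root_.map_ne_zero _).mpr hn
  have : NeZero (n : AlgebraicClosure k) := ⟨h0⟩
  have hpos : 0 < n := Nat.pos_of_ne_zero fun h => hn (by simp [h])
  obtain ⟨ζ, hζ⟩ := IsAlgClosed.exists_root (cyclotomic n (AlgebraicClosure k))
    (degree_cyclotomic_pos n _ hpos).ne'
  exact ⟨ζ, isRoot_cyclotomic_iff.mp hζ⟩

open IntermediateField in
theorem adjoin_primitiveRoots_eq {n : ℕ} (hn : n ≠ 0) {ζ : AlgebraicClosure k}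
    (hζ : IsPrimitiveRoot ζ n) :
    IntermediateField.adjoin k {ξ : AlgebraicClosure k | IsPrimitiveRoot ξ n} = k⟮ζ⟯ := by
  apply le_antisymm
  · rw [IntermediateField.adjoin_le_iff]
    intro ξ hξ
    have : NeZero n := ⟨hn⟩
    obtain ⟨i, -, rfl⟩ := hζ.eq_pow_of_pow_eq_one (IsPrimitiveRoot.pow_eq_one hξ)
    exact pow_mem (mem_adjoin_simple_self k ζ) i
  · exact IntermediateField.adjoin.mono k _ _ (by simpa using hζ)

open IntermediateField in
theorem degreeFn_eq_finrank {n : ℕ} (hn : n ≠ 0) {ζ : AlgebraicClosure k}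
    (hζ : IsPrimitiveRoot ζ n) : degreeFn k n = Module.finrank k k⟮ζ⟯ := by
  rw [degreeFn, adjoin_primitiveRoots_eq hn hζ]

theorem degreeFn_pos {n : ℕ} (hn : (n : k) ≠ 0) : 0 < degreeFn k n := by
  obtain ⟨ζ, hζ⟩ := exists_isPrimitiveRoot_algebraicClosure hn
  rw [degreeFn_eq_finrank (fun h => hn (by simp [h])) hζ]
  have := IntermediateField.adjoin.finiteDimensional (Algebra.IsIntegral.isIntegral (R := k) ζ)
  exact Module.finrank_pos

open IntermediateField in
-- If `ζ` has order `2 n`, then `ζ ^ 2` has order `n`, and `ζ` is a root of `X ^ 2 - ζ ^ 2`; so the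
-- extension has degree 1 or 2.
theorem degreeFn_two_mul {n : ℕ} (hn : (n : k) ≠ 0) (h2 : (2 : k) ≠ 0) :
    degreeFn k (2 * n) = degreeFn k n ∨ degreeFn k (2 * n) = 2 * degreeFn k n := by
  have hn0 : n ≠ 0 := fun h => hn (by simp [h])
  obtain ⟨ζ, hζ⟩ := exists_isPrimitiveRoot_algebraicClosure (k := k) (n := 2 * n)
    (by push_cast; exact mul_ne_zero h2 hn)
  have hζ2 : IsPrimitiveRoot (ζ ^ 2) n := hζ.pow (by omega) rfl
  rw [degreeFn_eq_finrank hn0 hζ2, degreeFn_eq_finrank (by omega) hζ]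
  have hle : k⟮ζ ^ 2⟯ ≤ k⟮ζ⟯ := by
    rw [adjoin_simple_le_iff]
    exact pow_mem (mem_adjoin_simple_self k ζ) 2
  have hmul := finrank_bot_mul_relfinrank hle
  have hfin := adjoin.finiteDimensional (Algebra.IsIntegral.isIntegral (R := k) ζ)
  have hpos : 0 < Module.finrank k k⟮ζ⟯ := Module.finrank_pos
  have hrel : relfinrank k⟮ζ ^ 2⟯ k⟮ζ⟯ ≤ 2 := by
    rw [relfinrank_eq_finrank_of_le hle]
    have hext : extendScalars hle = (k⟮ζ ^ 2⟯)⟮ζ⟯ := by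
      apply le_antisymm
      · rw [extendScalars_le_iff, adjoin_simple_le_iff]
        exact mem_adjoin_simple_self _ ζ
      · rw [adjoin_simple_le_iff]
        exact mem_adjoin_simple_self k ζ
    rw [hext, adjoin.finrank (Algebra.IsIntegral.isIntegral ζ)]
    set a : k⟮ζ ^ 2⟯ := ⟨ζ ^ 2, mem_adjoin_simple_self k (ζ ^ 2)⟩
    have hroot : aeval ζ (X ^ 2 - C a) = 0 := by
      simp [a, IntermediateField.algebraMap_apply]
    calc _ ≤ (X ^ 2 - C a).natDegree :=
          natDegree_le_natDegree (minpoly.min _ _ (monic_X_pow_sub_C a two_ne_zero) hroot)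
      _ = 2 := natDegree_X_pow_sub_C
  interval_cases h : relfinrank k⟮ζ ^ 2⟯ k⟮ζ⟯ <;> omega

/-- In an Artinian ring a non-zero-divisor is a unit, so `1 - ω ^ ν` cannot be mapped to 0 in a
field. -/
theorem IsPrincipalRoot.isPrimitiveRoot_map {A K : Type*} [CommRing A] [Algebra k A]
    [Module.Finite k A] [Field K] (φ : A →+* K) {ω : A} {n : ℕ} (hn : 0 < n)
    (hω : IsPrincipalRoot ω n) : IsPrimitiveRoot (φ ω) n := by
  have : IsArtinianRing A := IsArtinianRing.of_finite k A
  refine IsPrimitiveRoot.mk_of_lt _ hn (by rw [← map_pow, hω.1, map_one]) ?_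
  intro ν h0 hν h
  have hu := (IsArtinianRing.isUnit_of_mem_nonZeroDivisors (hω.2 ν h0 hν)).map φ
  rw [map_sub, map_one, map_pow, h, sub_self] at hu
  exact not_isUnit_zero hu

open IntermediateField in
theorem IsPrincipalRoot.natCast_ne_zero_and_degreeFn_le {Q : Modulus k} {ω : Q.Alg} {m n : ℕ}
    (hm : 0 < m) (hn : 0 < n) (hω : IsPrincipalRoot ω (m * n)) :
    (n : k) ≠ 0 ∧ degreeFn k n ≤ Q.dim := by
  obtain ⟨α, hα⟩ := IsAlgClosed.exists_aeval_eq_zero (AlgebraicClosure k) Q.poly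
    (natDegree_pos_iff_degree_pos.mp Q.deg_pos).ne'
  -- Evaluation at a root `α` of the modulus; its image lies in `k(α)`, of degree at most `N'`.
  let φ : Q.Alg →ₐ[k] AlgebraicClosure k := AdjoinRoot.liftAlgHom Q.poly (Algebra.ofId _ _) α hα
  have hfin : Module.Finite k Q.Alg := (AdjoinRoot.powerBasis' Q.monic).finite
  have hprim : IsPrimitiveRoot (φ ω) (m * n) :=
    hω.isPrimitiveRoot_map (k := k) (φ : Q.Alg →+* AlgebraicClosure k) (by positivity)
  have hζ : IsPrimitiveRoot (φ ω ^ m) n := hprim.pow (by positivity) rfl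
  have hne : NeZero n := ⟨hn.ne'⟩
  have hnK := hζ.neZero'.out
  refine ⟨fun h => hnK ?_, ?_⟩
  · rw [← map_natCast (algebraMap k (AlgebraicClosure k)), h, map_zero]
  rw [degreeFn_eq_finrank hn.ne' hζ]
  have hint : IsIntegral k α := Algebra.IsIntegral.isIntegral α
  have hmem : φ ω ∈ k⟮α⟯ := by
    induction ω using AdjoinRoot.induction_on with
    | ih p =>
      have : φ (AdjoinRoot.mk Q.poly p) = aeval α p :=
        AdjoinRoot.liftAlgHom_mk Q.poly (Algebra.ofId k (AlgebraicClosure k)) α hα p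
      rw [this]
      exact aeval_mem_adjoin_singleton k α |> algebra_adjoin_le_adjoin k _
  have hle : k⟮φ ω ^ m⟯ ≤ k⟮α⟯ := by
    rw [adjoin_simple_le_iff]
    exact pow_mem hmem m
  have := adjoin.finiteDimensional hint
  calc _ ≤ Module.finrank k k⟮α⟯ := finrank_le_of_le_right hle
    _ = (minpoly k α).natDegree := adjoin.finrank hint
    _ ≤ Q.dim := natDegree_le_natDegree (minpoly.min _ _ Q.monic hα)

end DegreeFn

/-! ### Growth of `f_k^∨`. -/

section InvDegreeFn

variable {k : Type u} [Field k]

theorem invDegreeFn_le {n i : ℕ} (hi : (i : k) ≠ 0) (h : n ≤ i * degreeFn k i) :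
    invDegreeFn k n ≤ degreeFn k i :=
  Nat.sInf_le ⟨i, hi, h, rfl⟩

theorem exists_invDegreeFn_eq (h2 : (2 : k) ≠ 0) (n : ℕ) :
    ∃ i : ℕ, (i : k) ≠ 0 ∧ n ≤ i * degreeFn k i ∧ invDegreeFn k n = degreeFn k i := by
  -- Outside characteristic 2 the powers of 2 are admissible indices, so the infimum is attained.
  have hi : ((2 ^ n : ℕ) : k) ≠ 0 := by
    push_cast
    exact pow_ne_zero n h2
  exact Nat.sInf_mem (s := {d | ∃ i : ℕ, (i : k) ≠ 0 ∧ n ≤ i * degreeFn k i ∧ d = degreeFn k i})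
    ⟨_, 2 ^ n, hi, Nat.lt_two_pow_self.le.trans (Nat.le_mul_of_pos_right _ (degreeFn_pos hi)), rfl⟩

theorem invDegreeFn_mono (h2 : (2 : k) ≠ 0) : Monotone (invDegreeFn k) := by
  intro m n hmn
  obtain ⟨i, hi, hni, h⟩ := exists_invDegreeFn_eq h2 n
  exact h ▸ invDegreeFn_le hi (hmn.trans hni)

/-- Let `i` be optimal for `n`. If `f_k(2 i) = 2 f_k(i)`, the index `2 i` already gains the factor
4; otherwise `f_k(2 i) = f_k(i)`, and `4 i` works at degree at most `2 f_k(i)`. -/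
theorem invDegreeFn_four_mul_le (h2 : (2 : k) ≠ 0) (n : ℕ) :
    invDegreeFn k (4 * n) ≤ 2 * invDegreeFn k n := by
  obtain ⟨i, hi, hni, h⟩ := exists_invDegreeFn_eq h2 n
  have hi2 : ((2 * i : ℕ) : k) ≠ 0 := by
    push_cast
    exact mul_ne_zero h2 hi
  have hi4 : ((2 * (2 * i) : ℕ) : k) ≠ 0 := by
    push_cast at hi2 ⊢
    exact mul_ne_zero h2 hi2
  rw [h]
  rcases degreeFn_two_mul hi h2 with hd | hd
  · have hpos := degreeFn_pos hi
    rcases degreeFn_two_mul hi2 h2 with hd' | hd'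
    · exact (invDegreeFn_le hi4 (by rw [hd', hd]; linarith)).trans (by omega)
    · exact (invDegreeFn_le hi4 (by rw [hd', hd]; nlinarith)).trans (by omega)
  · exact (invDegreeFn_le hi2 (by rw [hd]; linarith)).trans hd.le

/-- Double `i` until the degree first exceeds `m`: it is then still at most `2 m`, and index times
degree is at least `m i`. If the degree never exceeds `m`, the index `2 ^ m * i` is large enough by
itself. -/
theorem invDegreeFn_mul_le (h2 : (2 : k) ≠ 0) {m i : ℕ} (hi : (i : k) ≠ 0)
    (hm : degreeFn k i ≤ m) : invDegreeFn k (m * i) ≤ 2 * m := by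
  have hpow : ∀ r, ((2 ^ r * i : ℕ) : k) ≠ 0 := fun r => by
    push_cast
    exact mul_ne_zero (pow_ne_zero r h2) hi
  by_cases hex : ∃ r, m < degreeFn k (2 ^ r * i)
  · classical
    obtain ⟨r, hr⟩ : ∃ r, Nat.find hex = r + 1 :=
      Nat.exists_eq_succ_of_ne_zero fun h => by
        have := Nat.find_spec hex
        rw [h] at this
        simp at this
        omega
    have hlt := Nat.find_spec hex
    have hle := not_lt.mp (Nat.find_min hex (m := r) (by omega))
    rw [hr] at hlt
    have hd : degreeFn k (2 ^ (r + 1) * i) ≤ 2 * degreeFn k (2 ^ r * i) := by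
      rw [pow_succ', mul_assoc]
      rcases degreeFn_two_mul (hpow r) h2 with h | h <;> omega
    refine (invDegreeFn_le (hpow (r + 1)) ?_).trans (by omega)
    rw [mul_comm m i]
    exact Nat.mul_le_mul (Nat.le_mul_of_pos_left _ (by positivity)) hlt.le
  · push Not at hex
    refine (invDegreeFn_le (hpow m) ?_).trans ((hex m).trans (by omega))
    exact (Nat.mul_le_mul_right i Nat.lt_two_pow_self.le).trans
      (Nat.le_mul_of_pos_right _ (degreeFn_pos (hpow m)))

end InvDegreeFn

/-! ### Cost of one transform and of the base algorithm. -/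

theorem logb_two_natCast_nonneg (n : ℕ) : 0 ≤ Real.logb 2 n := by
  rcases Nat.eq_zero_or_pos n with h | h
  · simp [h]
  · exact Real.logb_nonneg (by norm_num) (by exact_mod_cast h)

theorem logb_two_natCast_le (n : ℕ) : Real.logb 2 n ≤ n := by
  rcases Nat.eq_zero_or_pos n with h | h
  · simp [h]
  · rw [Real.logb_le_iff_le_rpow (by norm_num) (by exact_mod_cast h), Real.rpow_natCast]
    exact_mod_cast Nat.lt_two_pow_self.le

theorem one_le_logb_two_natCast {n : ℕ} (h : 2 ≤ n) : 1 ≤ Real.logb 2 n := by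
  rw [Real.le_logb_iff_rpow_le (by norm_num) (by positivity), Real.rpow_one]
  exact_mod_cast h

section Transform

variable {k : Type u} [Field k] {Q : Modulus k} {ω : Q.Alg} {n : ℕ} {ι κ : Type}

theorem max_eq_mul_normalized {q m : ℕ} (hq : 0 < q) :
    max (q : ℝ) m = q * max 1 ((m : ℝ) / q) := by
  have hq' : (0 : ℝ) < q := by exact_mod_cast hq
  rw [mul_max_of_nonneg _ _ hq'.le, mul_one, mul_div_cancel₀ _ hq'.ne']

theorem DFTTransform.le_cost (T : DFTTransform Q ω n ι κ) (hn : 0 < n) (m : ℕ) :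
    ((Q.dim * n : ℕ) : ℝ) * (max 1 ((m : ℝ) / Q.dim) * Real.logb 2 n) ≤ 2 * T.cost m := by
  have hdft := T.prog.mul_logb_le (Nat.mul_ne_zero T.factor_pos.ne' hn.ne') T.prog_dft
  have hnle : n ≤ T.factor * n := Nat.le_mul_of_pos_left n T.factor_pos
  have hlog : Real.logb 2 n ≤ Real.logb 2 ((T.factor * n : ℕ) : ℝ) :=
    Real.logb_le_logb_of_le (by norm_num) (by exact_mod_cast hn) (by exact_mod_cast hnle)
  have hgates : (n : ℝ) * Real.logb 2 n ≤ 2 * T.prog.gates.length :=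
    (mul_le_mul (by exact_mod_cast hnle) hlog (logb_two_natCast_nonneg n)
      (Nat.cast_nonneg _)).trans hdft
  have hcost : T.prog.gates.length * (Q.dim + m) ≤ T.cost m := by
    have := Nat.le_mul_of_pos_left (T.prog.gates.length * (Q.dim + m)) T.count_pos
    unfold DFTTransform.cost
    omega
  have hmax : max (Q.dim : ℝ) m ≤ ((Q.dim + m : ℕ) : ℝ) := by
    push_cast
    exact max_le (by simp) (by simp)
  calc _ = max (Q.dim : ℝ) m * (n * Real.logb 2 n) := by
        rw [max_eq_mul_normalized Q.deg_pos]; push_cast; ring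
    _ ≤ ((Q.dim + m : ℕ) : ℝ) * (2 * T.prog.gates.length) :=
        mul_le_mul hmax hgates
          (mul_nonneg (Nat.cast_nonneg _) (logb_two_natCast_nonneg n)) (Nat.cast_nonneg _)
    _ = 2 * ((T.prog.gates.length * (Q.dim + m) : ℕ) : ℝ) := by push_cast; ring
    _ ≤ 2 * T.cost m := by gcongr

/-- `2 C` pays for the two programs over `k`. The DFTs contribute the product of their number `C`,
the step count `C (C n) (C + 1) log n`, and `N' + M* ≤ 2 N' M` per step. -/
theorem DFTTransform.cost_le (T : DFTTransform Q ω n ι κ) (hn : 2 ≤ n) (m : ℕ) {C : ℕ}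
    (hT : T.Bounded (Q.dim * n) C) :
    (T.cost m : ℝ) ≤ (2 * C + 2 * C ^ 3 * (C + 1)) *
      (((Q.dim * n : ℕ) : ℝ) * (max 1 ((m : ℝ) / Q.dim) * Real.logb 2 n)) := by
  obtain ⟨hfac, hcount, hpre, hpost, hgates⟩ := hT
  set q := Q.dim
  set M := max 1 ((m : ℝ) / q) with hM
  set l := Real.logb 2 n with hl
  have hM1 : 1 ≤ M := le_max_left _ _
  have hl1 : 1 ≤ l := one_le_logb_two_natCast hn
  have hfacR : (T.factor : ℝ) ≤ C := by exact_mod_cast hfac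
  -- As `n ≥ 2`, the term `log m ≤ C` from the extra factor of the order is absorbed by `C log n`.
  have hlog : Real.logb 2 ((T.factor * n : ℕ) : ℝ) ≤ (C + 1) * l := by
    have h1 : (T.factor : ℝ) ≠ 0 := by exact_mod_cast T.factor_pos.ne'
    have h2 : (n : ℝ) ≠ 0 := by positivity
    rw [Nat.cast_mul, Real.logb_mul h1 h2]
    have h3 := (logb_two_natCast_le T.factor).trans hfacR
    have h4 : (C : ℝ) * 1 ≤ C * l := by gcongr
    linarith
  have hgates' : (T.prog.gates.length : ℝ) ≤ C * (C * n) * ((C + 1) * l) := by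
    refine hgates.trans ?_
    have := logb_two_natCast_nonneg (T.factor * n)
    push_cast at this hlog ⊢
    gcongr
  have hqm : ((q + m : ℕ) : ℝ) ≤ 2 * (q * M) := by
    rw [← max_eq_mul_normalized Q.deg_pos]
    push_cast
    linarith [le_max_left (q : ℝ) m, le_max_right (q : ℝ) m]
  have hmid : ((T.count * (T.prog.gates.length * (q + m)) : ℕ) : ℝ) ≤
      C * ((C * (C * n) * ((C + 1) * l)) * (2 * (q * M))) := by
    rw [Nat.cast_mul, Nat.cast_mul]
    gcongr
  have hside : ((C * (q * n) : ℕ) : ℝ) ≤ C * (((q * n : ℕ) : ℝ) * (M * l)) := by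
    have : 1 ≤ M * l := one_le_mul_of_one_le_of_one_le hM1 hl1
    rw [Nat.cast_mul]
    gcongr
    exact le_mul_of_one_le_right (Nat.cast_nonneg _) this
  have hpre' : (T.pre.length : ℝ) ≤ ((C * (q * n) : ℕ) : ℝ) := by exact_mod_cast hpre
  have hpost' : (T.post.length : ℝ) ≤ ((C * (q * n) : ℕ) : ℝ) := by exact_mod_cast hpost
  unfold DFTTransform.cost
  rw [Nat.cast_add, Nat.cast_add]
  calc _ ≤ C * (((q * n : ℕ) : ℝ) * (M * l)) + C * ((C * (C * n) * ((C + 1) * l)) * (2 * (q * M)))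
        + C * (((q * n : ℕ) : ℝ) * (M * l)) :=
        add_le_add (add_le_add (hpre'.trans hside) hmid) (hpost'.trans hside)
    _ = _ := by push_cast; ring

end Transform

/-- Makes the lower bound positive at the base. Without steps each output is an input or a constant;
the products `1 * 1`, `1 * 0`, `0 * 1`, read at a coordinate where 1 is nonzero, exclude this. -/
theorem SLP.length_pos_of_computes_mul {k : Type u} [Field k] {P : Modulus k}
    (p : SLP k (Fin P.dim ⊕ Fin P.dim) (Fin P.dim))
    (hp : ∀ a b : P.Alg, p.eval (Sum.elim (P.coords a) (P.coords b)) = P.coords (a * b)) :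
    0 < p.length := by
  by_contra hlen
  have hsteps : p.steps = [] := List.length_eq_zero_iff.mp (by simpa [SLP.length] using hlen)
  have : Nontrivial P.Alg := AdjoinRoot.nontrivial _ (natDegree_pos_iff_degree_pos.mp P.deg_pos).ne'
  have h1 : P.coords 1 ≠ 0 := by simp
  obtain ⟨j, hj⟩ := Function.ne_iff.mp h1
  have h11 := congrFun (hp 1 1) j
  have h10 := congrFun (hp 1 0) j
  have h01 := congrFun (hp 0 1) j
  simp only [SLP.eval, SLP.values, hsteps, List.foldl_nil, mul_one, mul_zero, map_zero]
    at h11 h10 h01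
  rw [Pi.zero_apply] at h10 h01 hj
  rcases hout : p.out j with (i | i) | i | c <;> rw [hout] at h11 h10 h01 <;>
    simp only [Operand.eval, Sum.elim_inl, Sum.elim_inr, List.getD_nil] at h11 h10 h01
  · exact hj (h11.symm.trans h10)
  · exact hj (h11.symm.trans h01)
  · exact hj h11.symm
  · exact hj (h11.symm.trans h10)

/-! ### Unrolling the recursion: part 1. -/

namespace DFTAlg

variable {k : Type u} [Field k]

/-- The sum `∑ 2 ^ (λ - 1) * M(N'_λ) * log N''_λ` over the recursive steps of the algorithm. -/
noncomputable def transformSum {P : Modulus k} (D : DFTAlg P) : ℝ :=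
  ∑ i ∈ Finset.Icc 1 D.depth,
    2 ^ (i - 1) * (D.normMulPowCostAt i * Real.logb 2 (D.orderAt i))

theorem dimAt_zero {P : Modulus k} (D : DFTAlg P) : D.dimAt 0 = P.dim := by
  cases D <;> rfl

theorem transformSum_step {P Q : Modulus k} (s : RecStep P Q) (D : DFTAlg Q) :
    (step s D).transformSum = max 1 ((s.mulPowCost : ℝ) / Q.dim) * Real.logb 2 s.order +
      2 * D.transformSum := by
  have hIcc : ∀ (m : ℕ) (g : ℕ → ℝ),
      ∑ i ∈ Finset.Icc 1 m, g i = ∑ i ∈ Finset.range m, g (i + 1) := by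
    intro m g
    rw [Finset.range_eq_Ico, Finset.sum_Ico_add' g 0 m 1]
    rfl
  unfold transformSum
  rw [hIcc, hIcc, depth, Finset.sum_range_succ', Finset.mul_sum, add_comm]
  congr 1
  · simp [normMulPowCostAt, mulPowCostAt, dimAt, dimAt_zero, orderAt]
  · refine Finset.sum_congr rfl fun i _ => ?_
    simp only [normMulPowCostAt, mulPowCostAt, dimAt, orderAt, Nat.add_sub_cancel, pow_succ]
    ring

theorem transformSum_nonneg {P : Modulus k} (D : DFTAlg P) : 0 ≤ D.transformSum := by
  refine Finset.sum_nonneg fun i _ => mul_nonneg (by positivity) (mul_nonneg ?_ ?_)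
  · exact zero_le_one.trans (le_max_left _ _)
  · exact logb_two_natCast_nonneg _

/-- The base needs the factor `1 / C`, since `N ≤ C` there and the cost is at least 1. In a step,
the two applications of `ψ` alone cover the increment. -/
theorem le_cost {C : ℕ} (hC : 0 < C) {P : Modulus k} (D : DFTAlg P) (hD : D.Bounded C) :
    (1 / C : ℝ) * (P.dim * 2 ^ D.depth + P.dim * D.transformSum) ≤ D.cost := by
  have hC' : (1 : ℝ) ≤ C := by exact_mod_cast hC
  have hC0 : (0 : ℝ) < C := by linarith
  induction D with
  | @base P prog h =>
    have h1 : (1 : ℝ) ≤ prog.length := by exact_mod_cast prog.length_pos_of_computes_mul h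
    have h2 : (P.dim : ℝ) ≤ C := by exact_mod_cast hD.1
    simp only [transformSum, depth, cost]
    rw [div_mul_eq_mul_div, div_le_iff₀ hC0]
    simp
    nlinarith
  | @step P Q s D ih =>
    have ih := ih hD.2
    have hpsi := s.psi.le_cost (by linarith [s.two_le_order]) s.mulPowCost
    have hinv := s.psiInv.le_cost (by linarith [s.two_le_order]) s.mulPowCost
    have hdim : (P.dim : ℝ) = Q.dim * s.order := by exact_mod_cast s.dim_eq
    rw [transformSum_step, depth, cost, hdim]
    push_cast at hpsi hinv ⊢
    set X : ℝ := max 1 ((s.mulPowCost : ℝ) / Q.dim) * Real.logb 2 s.order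
    have hX : 0 ≤ Q.dim * s.order * X :=
      mul_nonneg (by positivity) (mul_nonneg (zero_le_one.trans (le_max_left _ _))
        (logb_two_natCast_nonneg _))
    have hX' : (1 / C : ℝ) * (Q.dim * s.order * X) ≤ 1 * (Q.dim * s.order * X) := by
      gcongr
      rw [div_le_one hC0]
      exact hC'
    have hmul : 2 * (s.order : ℝ) *
        ((1 / C : ℝ) * (Q.dim * 2 ^ D.depth + Q.dim * D.transformSum)) ≤
        2 * s.order * D.cost := by gcongr
    calc _ = 2 * (s.order : ℝ) *
          ((1 / C : ℝ) * (Q.dim * 2 ^ D.depth + Q.dim * D.transformSum)) +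
          (1 / C : ℝ) * (Q.dim * s.order * X) := by ring
      _ ≤ _ := by linarith

theorem cost_le {C : ℕ} {P : Modulus k} (D : DFTAlg P) (hD : D.Bounded C) :
    (D.cost : ℝ) ≤ (C + 3 * (2 * C + 2 * C ^ 3 * (C + 1))) *
      (P.dim * 2 ^ D.depth + P.dim * D.transformSum) := by
  induction D with
  | @base P prog h =>
    have h1 : (prog.length : ℝ) ≤ C := by exact_mod_cast hD.2
    have h2 : (1 : ℝ) ≤ P.dim := by exact_mod_cast P.deg_pos
    simp only [transformSum, depth, cost]
    simp
    have : (0 : ℝ) ≤ 3 * (2 * C + 2 * C ^ 3 * (C + 1)) := by positivity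
    nlinarith [mul_nonneg this (zero_le_one.trans h2)]
  | @step P Q s D ih =>
    have ih := ih hD.2
    have hpsi := s.psi.cost_le s.two_le_order s.mulPowCost (by rw [← s.dim_eq]; exact hD.1.2.1)
    have hinv := s.psiInv.cost_le s.two_le_order s.mulPowCost (by rw [← s.dim_eq]; exact hD.1.2.2)
    have hdim : (P.dim : ℝ) = Q.dim * s.order := by exact_mod_cast s.dim_eq
    rw [transformSum_step, depth, cost, hdim]
    push_cast at hpsi hinv ⊢
    set X : ℝ := max 1 ((s.mulPowCost : ℝ) / Q.dim) * Real.logb 2 s.order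
    set K : ℝ := 2 * C + 2 * C ^ 3 * (C + 1)
    have hX : 0 ≤ C * (Q.dim * s.order * X) :=
      mul_nonneg (by positivity) (mul_nonneg (by positivity)
        (mul_nonneg (zero_le_one.trans (le_max_left _ _)) (logb_two_natCast_nonneg _)))
    have hmul : 2 * (s.order : ℝ) * D.cost ≤ 2 * (s.order : ℝ) *
        ((C + 3 * K) * (Q.dim * 2 ^ D.depth + Q.dim * D.transformSum)) := by gcongr
    calc _ ≤ 2 * (s.order : ℝ) *
          ((C + 3 * K) * (Q.dim * 2 ^ D.depth + Q.dim * D.transformSum)) +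
          3 * (K * (Q.dim * s.order * X)) + C * (Q.dim * s.order * X) := by linarith
      _ = _ := by ring

end DFTAlg

/-! ### Iterates of `f_k^∨` and part 2. -/

/-- The lower bound `2 ^ s + ∑ 2 ^ (λ - 1) * log f^(λ)(n)` attached to the iterates of `f`, where
`s = f^*(n)`. -/
noncomputable def iterBound (f : ℕ → ℕ) (n : ℕ) : ℝ :=
  2 ^ iterStar f n + ∑ i ∈ Finset.Ico 1 (iterStar f n), 2 ^ (i - 1) * Real.logb 2 (f^[i] n)

theorem iterBound_nonneg (f : ℕ → ℕ) (n : ℕ) : 0 ≤ iterBound f n :=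
  add_nonneg (by positivity) (Finset.sum_nonneg fun i _ =>
    mul_nonneg (by positivity) (logb_two_natCast_nonneg _))

theorem iterBound_eq_one {f : ℕ → ℕ} {n : ℕ} (h : iterStar f n = 0) : iterBound f n = 1 := by
  simp [iterBound, h]

theorem one_le_iterBound (f : ℕ → ℕ) (n : ℕ) : 1 ≤ iterBound f n :=
  (one_le_pow₀ one_le_two).trans (le_add_of_nonneg_right (Finset.sum_nonneg fun i _ =>
    mul_nonneg (by positivity) (logb_two_natCast_nonneg _)))

theorem iterStar_eq_succ {f : ℕ → ℕ} {n : ℕ} (h : iterStar f n ≠ 0) :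
    iterStar f n = iterStar f (f n) + 1 := by
  have hne : f n ≠ n := by
    intro hfix
    apply h
    exact Nat.sInf_eq_zero.mpr (Or.inl (by simpa using hfix))
  -- A nonzero infimum comes from a nonempty set, so the sequence does become stationary here.
  have hmem : f^[iterStar f n + 1] n = f^[iterStar f n] n :=
    Nat.sInf_mem (s := {i | f^[i + 1] n = f^[i] n}) (Nat.nonempty_of_sInf_eq_succ
      (Nat.succ_pred_eq_of_ne_zero h).symm)
  obtain ⟨t, ht⟩ := Nat.exists_eq_succ_of_ne_zero h
  rw [ht] at hmem
  have ht' : f^[t + 1] (f n) = f^[t] (f n) := by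
    simpa only [Function.iterate_succ_apply] using hmem
  apply le_antisymm
  · refine Nat.sInf_le ?_
    exact Nat.sInf_mem (s := {i | f^[i + 1] (f n) = f^[i] (f n)}) ⟨t, ht'⟩
  · rw [ht]
    exact Nat.succ_le_succ (Nat.sInf_le ht')

/-- No stationarity has to be assumed: if the sequence from `n` never becomes stationary, `iterStar`
is 0 by convention and the left side is 1. -/
theorem iterBound_le (f : ℕ → ℕ) (n : ℕ) :
    iterBound f n ≤ 2 * iterBound f (f n) + Real.logb 2 (f n) := by
  have hlog := logb_two_natCast_nonneg (f n)
  by_cases h : iterStar f n = 0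
  · rw [iterBound_eq_one h]
    linarith [one_le_iterBound f (f n)]
  · have hs := iterStar_eq_succ h
    unfold iterBound
    rw [hs]
    set t := iterStar f (f n)
    rcases Nat.eq_zero_or_pos t with ht | ht
    · simpa [ht] using hlog
    · have hsum : ∑ i ∈ Finset.Ico 1 (t + 1), (2 : ℝ) ^ (i - 1) * Real.logb 2 (f^[i] n)
          = Real.logb 2 (f n) +
            2 * ∑ i ∈ Finset.Ico 1 t, (2 : ℝ) ^ (i - 1) * Real.logb 2 (f^[i] (f n)) := by
        rw [Finset.sum_eq_sum_Ico_succ_bot (by omega), Finset.mul_sum,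
          ← Finset.sum_Ico_add' _ 1 t 1]
        congr 1
        · simp
        · refine Finset.sum_congr rfl fun i hi => ?_
          obtain ⟨j, rfl⟩ := Nat.exists_eq_add_of_le' (Finset.mem_Ico.mp hi).1
          simp only [Nat.add_sub_cancel, pow_succ, Function.iterate_succ_apply]
          ring
      rw [hsum, pow_succ]
      apply le_of_eq
      ring

theorem RecStep.invDegreeFn_dim_le {k : Type u} [Field k] (h2 : (2 : k) ≠ 0) {P Q : Modulus k}
    (s : RecStep P Q) : invDegreeFn k P.dim ≤ 2 * Q.dim := by
  obtain ⟨hne, hle⟩ := IsPrincipalRoot.natCast_ne_zero_and_degreeFn_le s.mult_pos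
    (by linarith [s.two_le_order]) s.root_principal
  rw [s.dim_eq]
  exact invDegreeFn_mul_le h2 hne hle

/-- The slack `n ≤ 4 N` makes the induction close. The summand `log N + 2` is a potential: the
recursion doubles it for `N'`, and this exactly pays for `log f_k^∨(n) ≤ 2 + log N'` and for the new
`log N + 2`, up to `log N''`, which the transform sum supplies because `M ≥ 1`. The finite sum in
the constant covers every `n ≤ 4 C` at the base. -/
theorem DFTAlg.iterBound_le {k : Type u} [Field k] (h2 : (2 : k) ≠ 0) (C : ℕ) {P : Modulus k}
    (D : DFTAlg P) (hD : D.Bounded C) : ∀ n ≤ 4 * P.dim,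
    iterBound (invDegreeFn k) n + Real.logb 2 P.dim + 2 ≤
      (C + 2 + ∑ i ∈ Finset.range (4 * C + 1), iterBound (invDegreeFn k) i) * 2 ^ D.depth +
        D.transformSum := by
  induction D with
  | @base P prog h =>
    intro n hn
    have hdim : P.dim ≤ C := hD.1
    have h1 : iterBound (invDegreeFn k) n ≤
        ∑ i ∈ Finset.range (4 * C + 1), iterBound (invDegreeFn k) i :=
      Finset.single_le_sum (f := iterBound (invDegreeFn k)) (fun i _ => iterBound_nonneg _ i)
        (Finset.mem_range.mpr (by omega))
    have h3 : Real.logb 2 P.dim ≤ C :=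
      (logb_two_natCast_le _).trans (by exact_mod_cast hdim)
    simp only [transformSum, depth]
    simp
    linarith
  | @step P Q s D ih =>
    intro n hn
    set F := invDegreeFn k with hF
    have hFn : F n ≤ 4 * Q.dim :=
      calc F n ≤ F (4 * P.dim) := invDegreeFn_mono h2 hn
        _ ≤ 2 * F P.dim := invDegreeFn_four_mul_le h2 _
        _ ≤ 4 * Q.dim := by linarith [s.invDegreeFn_dim_le h2]
    have ih := ih hD.2 (F n) hFn
    have hq : (Q.dim : ℝ) ≠ 0 := by exact_mod_cast Q.deg_pos.ne'
    have ho : (s.order : ℝ) ≠ 0 := by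
      have := s.two_le_order
      positivity
    have hlogF : Real.logb 2 (F n) ≤ 2 + Real.logb 2 Q.dim := by
      rcases Nat.eq_zero_or_pos (F n) with h0 | h0
      · rw [h0]
        simp only [Nat.cast_zero, Real.logb_zero]
        linarith [logb_two_natCast_nonneg Q.dim]
      · calc _ ≤ Real.logb 2 (2 ^ 2 * Q.dim) :=
              Real.logb_le_logb_of_le (by norm_num) (by exact_mod_cast h0)
                (by norm_num; exact_mod_cast hFn)
          _ = _ := by
            rw [Real.logb_mul (by norm_num) hq, Real.logb_pow,
              Real.logb_self_eq_one (by norm_num)]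
            norm_num
    have hlogP : Real.logb 2 P.dim = Real.logb 2 Q.dim + Real.logb 2 s.order := by
      rw [s.dim_eq, Nat.cast_mul, Real.logb_mul hq ho]
    have hM : Real.logb 2 s.order ≤
        max 1 ((s.mulPowCost : ℝ) / Q.dim) * Real.logb 2 s.order :=
      le_mul_of_one_le_left (logb_two_natCast_nonneg _) (le_max_left _ _)
    have hrec := _root_.iterBound_le F n
    rw [transformSum_step, depth, hlogP, pow_succ]
    linarith

theorem mainTheorem1 {k : Type*} [Field k] (C : ℕ) :
    (∃ c₁ c₂ : ℝ, 0 < c₁ ∧ 0 < c₂ ∧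
      ∀ (P : Modulus k) (D : DFTAlg P), D.Bounded C →
        c₁ * ((P.dim : ℝ) * 2 ^ D.depth +
            (P.dim : ℝ) * ∑ i ∈ Finset.Icc 1 D.depth,
              2 ^ (i - 1) * (D.normMulPowCostAt i * Real.logb 2 (D.orderAt i))) ≤ D.cost ∧
        (D.cost : ℝ) ≤ c₂ * ((P.dim : ℝ) * 2 ^ D.depth +
            (P.dim : ℝ) * ∑ i ∈ Finset.Icc 1 D.depth,
              2 ^ (i - 1) * (D.normMulPowCostAt i * Real.logb 2 (D.orderAt i)))) ∧
    (ringChar k ≠ 2 →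
      ∃ c : ℝ, 0 < c ∧
        ∀ (P : Modulus k) (D : DFTAlg P), D.Bounded C →
          c * ((P.dim : ℝ) * 2 ^ iterStar (invDegreeFn k) P.dim +
            (P.dim : ℝ) * ∑ i ∈ Finset.Ico 1 (iterStar (invDegreeFn k) P.dim),
              2 ^ (i - 1) * Real.logb 2 ((invDegreeFn k)^[i] P.dim)) ≤ D.cost) := by
  -- For `C = 0` no algorithm is bounded, as the base dimension is positive; any constants then
  -- serve.
  have hCpos : ∀ {P : Modulus k} (D : DFTAlg P), D.Bounded C → 0 < C := by
    intro P D hD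
    induction D with
    | @base P prog h => exact P.deg_pos.trans_le hD.1
    | step s D ih => exact ih hD.2
  by_cases hC : 0 < C
  swap
  · exact ⟨⟨1, 1, one_pos, one_pos, fun P D hD => absurd (hCpos D hD) hC⟩,
      fun _ => ⟨1, one_pos, fun P D hD => absurd (hCpos D hD) hC⟩⟩
  have hCR : (0 : ℝ) < C := by exact_mod_cast hC
  refine ⟨⟨1 / C, C + 3 * (2 * C + 2 * C ^ 3 * (C + 1)), by positivity, by positivity,
    fun P D hD => ⟨D.le_cost hC hD, D.cost_le hD⟩⟩, fun hchar => ?_⟩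
  have h2 : (2 : k) ≠ 0 := Ring.two_ne_zero hchar
  set K : ℝ := C + 2 + ∑ i ∈ Finset.range (4 * C + 1), iterBound (invDegreeFn k) i with hK
  have hK1 : 1 ≤ K := by
    have := Finset.sum_nonneg (s := Finset.range (4 * C + 1))
      fun i _ => iterBound_nonneg (invDegreeFn k) i
    linarith
  refine ⟨1 / K * (1 / C), by positivity, fun P D hD => ?_⟩
  have hlow := D.le_cost hC hD
  have hiter := D.iterBound_le h2 C hD P.dim (by omega)
  rw [← hK] at hiter
  have hbound : iterBound (invDegreeFn k) P.dim ≤ K * (2 ^ D.depth + D.transformSum) := by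
    have h3 := le_mul_of_one_le_left D.transformSum_nonneg hK1
    linarith [logb_two_natCast_nonneg P.dim]
  calc _ = 1 / C * (P.dim * (1 / K * iterBound (invDegreeFn k) P.dim)) := by
        unfold iterBound
        ring
    _ ≤ 1 / C * (P.dim * (1 / K * (K * (2 ^ D.depth + D.transformSum)))) := by gcongr
    _ = 1 / C * (P.dim * 2 ^ D.depth + P.dim * D.transformSum) := by
        field_simp
    _ ≤ D.cost := hlow
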